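/- Call a group $2$-generated if it can be generated by two (not necessarily distinct) elements, and call a positive integer $n$ a $2$-generated number if every group of order $n$ is $2$-generated. Let $n$ be an odd positive integer with prime factorization $n=p_1^{e_1}p_2^{e_2}\cdots p_k^{e_k}$, where $p_1>p_2>\cdots>p_k$ are distinct primes and each $e_i$ is a positive integer ($k=0$ if $n=1$). Then $n$ is a $2$-generated number if and only if $n$ is cube-free (that is, not divisible by the cube of any prime) and, for all $i<j$, $p_j\nmid (p_i-1)$ or $e_i=1$. -/

import Mathlib

universe u

/-- A group is 2-generated if it can be generated by two (not necessarily distinct) elements. -/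
def IsTwoGenerated (G : Type u) [Group G] : Prop :=
  ∃ a b : G, Subgroup.closure {a, b} = (⊤ : Subgroup G)

/-- A positive integer `n` is a 2-generated number if every group of order `n` is 2-generated.
Every finite group is isomorphic to one in each universe, so the choice of `u` is immaterial. -/
def IsTwoGeneratedNumber (n : ℕ) : Prop :=
  ∀ (G : Type u) [Group G], Nat.card G = n → IsTwoGenerated G

/-- `n` is cube-free if no cube of a prime divides `n`. -/
def IsCubeFree (n : ℕ) : Prop :=
  ∀ q : ℕ, q.Prime → ¬ q ^ 3 ∣ n

/-!
**Necessity.** Quotients of 2-generated groups are 2-generated, so it is enough to find, for a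
suitable divisor `a` of `n`, a group of order `a` that is not 2-generated, and to multiply it by a
cyclic group. If `r ^ 3 ∣ n`, take `(ZMod r) ^ 3`. If `r ^ 2 * q ∣ n` with `q ∣ r - 1`, take
`V ⋊ C`, where `V = (ZMod r) ^ 2` and `C` is a group of `q` scalars: regarded as an affine map of
`V`, an element outside `V` has a fixed point `x`, and the subgroup that it generates together with
`b` moves `x` only along the line spanned by `b x - x`
(`not_isTwoGenerated_semidirectProduct`).

**Sufficiency.** A group `G` of odd cube-free order is solvable without the Feit-Thompson theorem:
the automorphism group of a group of order `p` or `p ^ 2`, with `p` odd, has no elements of prime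
order greater than `p`, so Burnside's theorem gives a normal complement to a Sylow subgroup for the
smallest prime `p` (`isSolvable_of_odd_of_isCubeFree`). Hence a minimal normal subgroup `N` of `G`
is abelian of order `p` or `p ^ 2`. By induction `G ⧸ N` is generated by the images of some `x` and
`y`. If no pair `x * a`, `y * b` with `a b : N` generates `G`, every one of these `|N| ^ 2` pairs
generates a complement of `N`, and these complements correspond to different crossed homomorphisms
from a fixed complement `H` to `N` (`isTwoGenerated_of_quotient`). There are at most `|N|` of those
(`IsCrossedHom.exists_injective_invariant`), a contradiction:
* if `p` does not divide `|H|`, a crossed homomorphism is determined by the product of its values;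
* if `p` divides `|H|`, then `|N| = p` and `p ^ 2` divides `|G|`, so by hypothesis `p - 1` is prime
  to `|G|` and `N` is central. Crossed homomorphisms are then homomorphisms, and these are
  determined by the value at one element of order `p`, because `p ^ 2` does not divide `|H|`.
-/

/-! ### Groups that are not 2-generated -/

theorem IsTwoGenerated.of_surjective {G H : Type*} [Group G] [Group H] (f : G →* H)
    (hf : Function.Surjective f) (h : IsTwoGenerated G) : IsTwoGenerated H := by
  obtain ⟨a, b, hab⟩ := h
  refine ⟨f a, f b, ?_⟩
  rw [← Set.image_pair, ← MonoidHom.map_closure, hab, ← MonoidHom.range_eq_map,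
    MonoidHom.range_eq_top.mpr hf]

/-- The direct factor `ZMod m` brings the order to `a * m`; this includes `m = 0`, as `ZMod 0` is
infinite and `Nat.card` is then `0`. -/
theorem IsTwoGeneratedNumber.of_mul {a m : ℕ} (h : IsTwoGeneratedNumber.{u} (a * m))
    (G : Type) [Group G] (hG : Nat.card G = a) : IsTwoGenerated G := by
  have h1 : Nat.card (ULift.{u} (G × Multiplicative (ZMod m))) = a * m := by
    rw [Nat.card_congr Equiv.ulift, Nat.card_prod, hG, Nat.card_congr Multiplicative.toAdd,
      Nat.card_zmod]
  exact (h _ h1).of_surjective ((MonoidHom.fst _ _).comp MulEquiv.ulift.toMonoidHom)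
    (fun g => ⟨ULift.up (g, 1), rfl⟩)

theorem not_isTwoGenerated_multiplicative {F V : Type*} [Field F] [AddCommGroup V] [Module F V]
    (hV : 2 < Module.finrank F V) : ¬ IsTwoGenerated (Multiplicative V) := by
  classical
  rintro ⟨a, b, hab⟩
  have hspan : Submodule.span F {a.toAdd, b.toAdd} = ⊤ := by
    rw [eq_top_iff]
    rintro v -
    have hv : Multiplicative.ofAdd v ∈ Subgroup.closure {a, b} := hab ▸ Subgroup.mem_top _
    have hle : Subgroup.closure {a, b} ≤
        (Submodule.span F {a.toAdd, b.toAdd}).toAddSubgroup.toSubgroup := by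
      rw [Subgroup.closure_le]
      rintro x (rfl | rfl)
      · exact (Submodule.subset_span (Set.mem_insert x.toAdd {b.toAdd}) :
          x.toAdd ∈ Submodule.span F {x.toAdd, b.toAdd})
      · exact (Submodule.subset_span (Set.mem_insert_of_mem _ rfl) :
          x.toAdd ∈ Submodule.span F {a.toAdd, x.toAdd})
    exact hle hv
  have h1 := finrank_span_finset_le_card (R := F) ({a.toAdd, b.toAdd} : Finset V)
  rw [Set.finrank, Finset.coe_pair, hspan, finrank_top] at h1
  have := Finset.card_le_two (a := a.toAdd) (b := b.toAdd)
  omega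

/-- The action of a group `C` of nonzero scalars of a field on a vector space, written
multiplicatively. -/
def scalarAction {F : Type*} (V : Type*) [Field F] [AddCommGroup V] [Module F V]
    (C : Subgroup Fˣ) : C →* MulAut (Multiplicative V) where
  toFun c := (MulAutMultiplicative V).symm (DistribMulAction.toAddAut Fˣ V c)
  map_one' := by ext; simp
  map_mul' _ _ := by ext; simp [mul_smul]

theorem toAdd_scalarAction {F V : Type*} [Field F] [AddCommGroup V] [Module F V]
    (C : Subgroup Fˣ) (c : C) (v : Multiplicative V) :
    (scalarAction V C c v).toAdd = ((c : Fˣ) : F) • v.toAdd := rfl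

/-- The affine transformation given by `a` fixes a point `x`, and the elements that move `x` within
the line spanned by its displacement under `b` form a subgroup containing `a` and `b`. -/
theorem closure_ne_top_of_right_ne_one {F V : Type*} [Field F] [AddCommGroup V] [Module F V]
    (hV : 1 < Module.finrank F V) (C : Subgroup Fˣ)
    (a b : Multiplicative V ⋊[scalarAction V C] C) (ha : a.right ≠ 1) :
    Subgroup.closure {a, b} ≠ ⊤ := by
  intro hab
  have hne : (1 : F) - ((a.right : Fˣ) : F) ≠ 0 := by
    rw [sub_ne_zero]
    intro h
    exact ha (Subtype.ext (Units.ext h.symm))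
  set x : V := (1 - ((a.right : Fˣ) : F))⁻¹ • a.left.toAdd with hx
  -- the displacement of `x` under the affine transformation `v ↦ g.left + g.right • v`
  let δ (g : Multiplicative V ⋊[scalarAction V C] C) : V :=
    g.left.toAdd + ((g.right : Fˣ) : F) • x - x
  have hδ : ∀ g h, δ (g * h) = δ g + ((g.right : Fˣ) : F) • δ h := by
    intro g h
    simp only [δ, SemidirectProduct.mul_left, SemidirectProduct.mul_right, toAdd_mul,
      toAdd_scalarAction, Subgroup.coe_mul, Units.val_mul]
    module
  have hδ1 : δ 1 = 0 := by simp [δ]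
  have key : ∀ g ∈ Subgroup.closure {a, b}, δ g ∈ Submodule.span F {δ b} := by
    intro g hg
    induction hg using Subgroup.closure_induction with
    | mem g hg =>
      rcases hg with rfl | rfl
      · have : δ g = 0 := by
          have h2 : x - ((g.right : Fˣ) : F) • x = g.left.toAdd := by
            rw [← smul_inv_smul₀ hne g.left.toAdd, ← hx, sub_smul, one_smul]
          simp only [δ, ← h2]
          abel
        rw [this]
        exact zero_mem _
      · exact Submodule.mem_span_singleton_self _
    | one => rw [hδ1]; exact zero_mem _
    | mul g h _ _ ihg ihh => rw [hδ]; exact add_mem ihg (Submodule.smul_mem _ _ ihh)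
    | inv g _ ih =>
      have h1 := hδ g⁻¹ g
      rw [inv_mul_cancel, hδ1] at h1
      rw [eq_neg_of_add_eq_zero_left h1.symm]
      exact neg_mem (Submodule.smul_mem _ _ ih)
  have htop : Submodule.span F {δ b} = ⊤ := by
    rw [eq_top_iff]
    rintro v -
    have := key (SemidirectProduct.inl (Multiplicative.ofAdd v)) (hab ▸ Subgroup.mem_top _)
    simpa [δ] using this
  have := finrank_span_le_card (R := F) ({δ b} : Set V)
  rw [htop, finrank_top, Set.toFinset_singleton, Finset.card_singleton] at this
  omega

theorem not_isTwoGenerated_semidirectProduct {F V : Type*} [Field F] [AddCommGroup V]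
    [Module F V] (hV : 1 < Module.finrank F V) {C : Subgroup Fˣ} (hC : C ≠ ⊥) :
    ¬ IsTwoGenerated (Multiplicative V ⋊[scalarAction V C] C) := by
  rintro ⟨a, b, hab⟩
  by_cases ha : a.right = 1
  · by_cases hb : b.right = 1
    · obtain ⟨c, hc1⟩ := Subgroup.ne_bot_iff_exists_ne_one.mp hC
      have hle : Subgroup.closure {a, b} ≤
          (SemidirectProduct.rightHom (φ := scalarAction V C)).ker := by
        rw [Subgroup.closure_le]
        rintro x (rfl | rfl)
        · exact ha
        · exact hb
      have : SemidirectProduct.inr (φ := scalarAction V C) c ∈ Subgroup.closure {a, b} :=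
        hab ▸ Subgroup.mem_top _
      exact hc1 (hle this)
    · rw [Set.pair_comm] at hab
      exact closure_ne_top_of_right_ne_one hV C b a hb hab
  · exact closure_ne_top_of_right_ne_one hV C a b ha hab

theorem IsTwoGeneratedNumber.isCubeFree {n : ℕ} (h : IsTwoGeneratedNumber.{u} n) :
    IsCubeFree n := by
  rintro p hp ⟨m, rfl⟩
  have : Fact p.Prime := ⟨hp⟩
  refine not_isTwoGenerated_multiplicative (F := ZMod p) (V := Fin 3 → ZMod p) (by simp)
    (h.of_mul _ ?_)
  rw [Nat.card_congr Multiplicative.toAdd]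
  simp

theorem IsTwoGeneratedNumber.not_sq_dvd {n q r : ℕ} (h : IsTwoGeneratedNumber.{u} n)
    (hq : q.Prime) (hr : r.Prime) (hqn : q ∣ n) (hqr : q ∣ r - 1) : ¬ r ^ 2 ∣ n := by
  intro hrn
  have : Fact r.Prime := ⟨hr⟩
  have hne : q ≠ r := by
    rintro rfl
    have := Nat.le_of_dvd (Nat.sub_pos_of_lt hr.one_lt) hqr
    have := hr.pos
    omega
  obtain ⟨m, rfl⟩ := Nat.Coprime.mul_dvd_of_dvd_of_dvd
    (Nat.Coprime.pow_left 2 ((Nat.coprime_primes hr hq).mpr hne.symm)) hrn hqn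
  have : Fact q.Prime := ⟨hq⟩
  obtain ⟨c, hc⟩ := exists_prime_orderOf_dvd_card' (G := (ZMod r)ˣ) q
    (by rwa [Nat.card_eq_fintype_card, ZMod.card_units])
  have hC : Nat.card (Subgroup.zpowers c) = q := by rw [Nat.card_zpowers, hc]
  refine not_isTwoGenerated_semidirectProduct (F := ZMod r) (V := Fin 2 → ZMod r) (by simp)
    (C := Subgroup.zpowers c) ?_ (h.of_mul _ ?_)
  · intro hbot
    rw [hbot, Subgroup.card_bot] at hC
    exact hq.one_lt.ne hC
  · rw [SemidirectProduct.card, hC, Nat.card_congr Multiplicative.toAdd]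
    simp

/-! ### Solvability and minimal normal subgroups -/

theorem IsCubeFree.of_dvd {m n : ℕ} (h : IsCubeFree n) (hmn : m ∣ n) : IsCubeFree m :=
  fun q hq hqm => h q hq (hqm.trans hmn)

/-- The number of points moved by an automorphism of prime order `q` is a multiple of `q`, and it is
`p - 1`, `p ^ 2 - 1` or `p * (p - 1)`. For `q > p` this leaves only `q = p + 1`, which is even. -/
theorem MulAut.orderOf_ne_of_prime_lt {P : Type*} [Group P] [Finite P] {p q e : ℕ} (hp : p.Prime)
    (hp2 : Odd p) (hq : q.Prime) (hpq : p < q) (hP : Nat.card P = p ^ e) (he : e ≤ 2)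
    (τ : MulAut P) : orderOf τ ≠ q := by
  intro hτ
  have : Fact q.Prime := ⟨hq⟩
  have hQ : IsPGroup q (Subgroup.zpowers τ) :=
    IsPGroup.of_card (n := 1) (by rw [Nat.card_zpowers, hτ, pow_one])
  have hmod := hQ.card_modEq_card_fixedPoints P
  let F : Subgroup P := τ.toMonoidHom.eqLocus (MonoidHom.id P)
  have hF : MulAction.fixedPoints (Subgroup.zpowers τ) P = (F : Set P) := by
    ext x
    constructor
    · intro hx
      exact hx ⟨τ, Subgroup.mem_zpowers τ⟩
    · rintro hx ⟨g, hg⟩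
      have : Subgroup.zpowers τ ≤ MulAction.stabilizer (MulAut P) x := by
        rw [Subgroup.zpowers_le]
        exact hx
      exact this hg
  have hcF : Nat.card (MulAction.fixedPoints (Subgroup.zpowers τ) P) = Nat.card F := by
    rw [hF]; rfl
  rw [hcF, hP] at hmod
  obtain ⟨j, hj, hjF⟩ := (Nat.dvd_prime_pow hp).mp (hP ▸ Subgroup.card_subgroup_dvd_card F)
  have hje : j ≠ e := by
    rintro rfl
    have htop : F = ⊤ := Subgroup.eq_top_of_card_eq F (hjF.trans hP.symm)
    have : τ = 1 := by
      ext x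
      exact (htop ▸ Subgroup.mem_top x : x ∈ F)
    rw [this, orderOf_one] at hτ
    exact hq.one_lt.ne hτ
  rw [hjF] at hmod
  have hdvd : q ∣ p ^ e - p ^ j :=
    (Nat.modEq_iff_dvd' (Nat.pow_le_pow_right hp.pos hj)).mp hmod.symm
  have hqp : ¬ q ∣ p := fun h => (Nat.le_of_dvd hp.pos h).not_gt hpq
  have h1 : ¬ q ∣ p - 1 := fun h => by
    have := Nat.le_of_dvd (Nat.sub_pos_of_lt hp.one_lt) h
    omega
  -- otherwise `q = p + 1`, which is even and greater than `2`
  have h2 : ¬ q ∣ p + 1 := fun h => by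
    have := Nat.le_of_dvd (Nat.succ_pos p) h
    have hqe : q = p + 1 := by omega
    have h2q : Even q := hqe ▸ hp2.add_one
    have := (hq.even_iff).mp h2q
    have := hp.two_le
    omega
  have hfac : p ^ e - p ^ j = p ^ j * (p ^ (e - j) - 1) := by
    rw [Nat.mul_sub, mul_one, ← pow_add, Nat.add_sub_cancel' hj]
  rw [hfac, hq.dvd_mul] at hdvd
  rcases hdvd with h | h
  · exact hqp (hq.dvd_of_dvd_pow h)
  · have : e - j = 1 ∨ e - j = 2 := by omega
    rcases this with h3 | h3
    · rw [h3, pow_one] at h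
      exact h1 h
    · rw [h3, show p ^ 2 - 1 = (p + 1) * (p - 1) by rw [← Nat.sq_sub_sq, one_pow],
        hq.dvd_mul] at h
      exact h.elim h2 h1

theorem Sylow.normalizer_le_centralizer_of_isCubeFree {G : Type*} [Group G] [Finite G] {p : ℕ}
    [hp : Fact p.Prime] (hodd : Odd (Nat.card G)) (hcf : IsCubeFree (Nat.card G))
    (hmin : (Nat.card G).minFac = p) (P : Sylow p G) :
    Subgroup.normalizer (P : Set G) ≤ Subgroup.centralizer (P : Set G) := by
  have hpG : p ∣ Nat.card G := hmin ▸ Nat.minFac_dvd _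
  obtain ⟨e, he⟩ := P.2.exists_card_eq
  have he2 : e ≤ 2 := by
    by_contra! h
    exact hcf p hp.out ((pow_dvd_pow p h).trans (he ▸ Subgroup.card_subgroup_dvd_card _))
  have hcomm : IsMulCommutative P := by
    interval_cases e
    · have := (Nat.card_eq_one_iff_unique.mp (he.trans (pow_zero p))).1
      exact ⟨⟨fun a b => Subsingleton.elim _ _⟩⟩
    · have := isCyclic_of_prime_card (he.trans (pow_one p))
      exact ⟨⟨(IsCyclic.commGroup (α := P)).mul_comm⟩⟩
    · exact IsPGroup.isMulCommutative_of_card_eq_prime_sq he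
  let φ := (P : Subgroup G).normalizerMonoidHom
  suffices hφ : ∀ g, φ g = 1 by
    have : φ.ker = ⊤ := by
      rw [eq_top_iff]
      exact fun g _ => hφ g
    rw [Subgroup.normalizerMonoidHom_ker, Subgroup.subgroupOf_eq_top] at this
    exact this
  intro g
  by_contra hg
  obtain ⟨q, hq, hqg⟩ := Nat.exists_prime_and_dvd (mt orderOf_eq_one_iff.mp hg)
  have hqG : q ∣ Nat.card G :=
    hqg.trans ((orderOf_map_dvd φ g).trans ((orderOf_dvd_natCard g).trans
      (Subgroup.card_subgroup_dvd_card _)))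
  -- `P` is abelian and acts trivially on itself, which excludes `q = p`
  rcases (hmin ▸ Nat.minFac_le_of_dvd hq.two_le hqG : p ≤ q).eq_or_lt with rfl | hlt
  · have h1 : orderOf (φ g) ∣ φ.ker.index := by
      rw [Subgroup.index_ker, ← Subgroup.orderOf_mk (φ g) (MonoidHom.mem_range.mpr ⟨g, rfl⟩)]
      exact orderOf_dvd_natCard _
    refine P.not_dvd_index (hqg.trans (h1.trans ?_))
    rw [Subgroup.normalizerMonoidHom_ker]
    refine (Subgroup.relIndex_dvd_of_le_left _ ?_).trans
      (Subgroup.relIndex_dvd_index_of_le (Subgroup.le_normalizer (H := (P : Subgroup G))))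
    exact Subgroup.le_centralizer _
  · refine MulAut.orderOf_ne_of_prime_lt hp.out (Odd.of_dvd_nat hodd hpG) hq hlt he he2
      (φ g ^ (orderOf (φ g) / q)) ?_
    exact orderOf_pow_orderOf_div (orderOf_pos _).ne' hqg

theorem isSolvable_of_odd_of_isCubeFree {G : Type*} [Group G] (hodd : Odd (Nat.card G))
    (hcf : IsCubeFree (Nat.card G)) : Group.IsSolvable G := by
  induction hn : Nat.card G using Nat.strong_induction_on generalizing G with
  | _ n ih =>
    have : Finite G := Nat.finite_of_card_ne_zero hodd.pos.ne'
    by_cases h1 : Nat.card G = 1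
    · have := (Nat.card_eq_one_iff_unique.mp h1).1
      infer_instance
    have : Fact (Nat.card G).minFac.Prime := ⟨Nat.minFac_prime h1⟩
    let P : Sylow (Nat.card G).minFac G := default
    have hP := P.normalizer_le_centralizer_of_isCubeFree hodd hcf rfl
    let K := (MonoidHom.transferSylow P hP).ker
    have hdvd : Nat.card K ∣ Nat.card G := Subgroup.card_subgroup_dvd_card K
    have hne : Nat.card K ≠ Nat.card G := fun h =>
      MonoidHom.not_dvd_card_ker_transferSylow P hP ((Nat.minFac_dvd _).trans h.symm.dvd)
    have hK : Group.IsSolvable K := ih (Nat.card K)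
      ((Nat.le_of_dvd Nat.card_pos hdvd |>.lt_of_ne hne).trans_eq hn) (hodd.of_dvd_nat hdvd)
      (hcf.of_dvd hdvd) rfl
    have hPn : Group.IsNilpotent P := P.2.isNilpotent
    have hPs : Group.IsSolvable P := inferInstance
    exact Group.isSolvable_of_ker_le_range K.subtype (MonoidHom.transferSylow P hP)
      (by rw [Subgroup.range_subtype])

theorem exists_minimal_normal_of_isSolvable {G : Type*} [Group G] [Finite G] [Nontrivial G]
    [Group.IsSolvable G] (hcf : IsCubeFree (Nat.card G)) :
    ∃ (N : Subgroup G) (p : ℕ), N.Normal ∧ IsMulCommutative N ∧ p.Prime ∧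
      (Nat.card N = p ∨ Nat.card N = p ^ 2) ∧
      ∀ M : Subgroup G, M.Normal → M ≤ N → M = ⊥ ∨ M = N := by
  obtain ⟨N, -, hN⟩ := exists_minimal_le_of_wellFoundedLT
    (fun M : Subgroup G => M.Normal ∧ M ≠ ⊥) ⊤ ⟨inferInstance, top_ne_bot⟩
  have hnorm : N.Normal := hN.prop.1
  have hmin : ∀ M : Subgroup G, M.Normal → M ≤ N → M = ⊥ ∨ M = N := fun M hM hle =>
    or_iff_not_imp_left.mpr fun hbot => hle.antisymm (hN.le_of_le ⟨hM, hbot⟩ hle)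
  have hcomm : IsMulCommutative N := by
    have hlt := Group.IsSolvable.commutator_lt_of_ne_bot hN.prop.2
    have hb := (hmin ⁅N, N⁆ inferInstance hlt.le).resolve_right hlt.ne
    rw [Subgroup.commutator_eq_bot_iff_le_centralizer] at hb
    exact ⟨⟨fun a b => Subtype.ext (hb b.2 a a.2)⟩⟩
  obtain ⟨p, hp, hpN⟩ := Nat.exists_prime_and_dvd
    (mt Subgroup.card_eq_one.mp hN.prop.2)
  have : Fact p.Prime := ⟨hp⟩
  have hcommN : ∀ a ∈ N, ∀ b ∈ N, a * b = b * a := fun a ha b hb =>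
    setLike_mul_comm ha hb
  -- the elements of `N` of exponent `p` form a nontrivial normal subgroup, hence all of `N`
  let T : Subgroup G :=
    { carrier := {x | x ∈ N ∧ x ^ p = 1}
      one_mem' := ⟨one_mem N, one_pow p⟩
      mul_mem' := fun {a b} ha hb => ⟨mul_mem ha.1 hb.1, by
        rw [(show Commute a b from hcommN a ha.1 b hb.1).mul_pow, ha.2, hb.2, one_mul]⟩
      inv_mem' := fun {a} ha => ⟨inv_mem ha.1, by rw [inv_pow, ha.2, inv_one]⟩ }
  have hT : T.Normal := ⟨fun x hx g => ⟨hnorm.conj_mem x hx.1 g, by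
    rw [conj_pow, hx.2, mul_one, mul_inv_cancel]⟩⟩
  have hTN : T = N := by
    refine (hmin T hT fun x hx => hx.1).resolve_left fun hbot => ?_
    obtain ⟨z, hz⟩ := exists_prime_orderOf_dvd_card' p hpN
    have h1 : (z : G) ∈ T := ⟨z.2, by
      rw [← Subgroup.coe_pow, ← hz, pow_orderOf_eq_one, Subgroup.coe_one]⟩
    rw [hbot, Subgroup.mem_bot] at h1
    rw [(Subtype.ext h1 : z = 1), orderOf_one] at hz
    exact hp.one_lt.ne hz
  have hpg : IsPGroup p N := fun x => ⟨1, by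
    rw [pow_one]
    exact Subtype.ext (hTN.ge x.2).2⟩
  obtain ⟨e, he⟩ := hpg.exists_card_eq
  refine ⟨N, p, hnorm, hcomm, hp, ?_, hmin⟩
  have he2 : e ≤ 2 := by
    by_contra! h
    exact hcf p hp ((pow_dvd_pow p h).trans (he ▸ Subgroup.card_subgroup_dvd_card _))
  interval_cases e
  · rw [he, pow_zero, Nat.dvd_one] at hpN
    exact absurd hpN hp.ne_one
  · exact .inl (he.trans (pow_one p))
  · exact .inr he

/-! ### Crossed homomorphisms and lifting of generators -/

/-- A crossed homomorphism from `H` to the normal subgroup `N`, for the right action of `H` on `N`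
by conjugation. -/
def IsCrossedHom {G : Type*} [Group G] {N H : Subgroup G} [N.Normal] (d : H → N) : Prop :=
  ∀ a b : H, d (a * b) = MulAut.conjNormal (b : G)⁻¹ (d a) * d b

open scoped IsMulCommutative in
/-- Writing `c` for the product of all values of `d`, the crossed homomorphism identity gives
`c = (b⁻¹ * c * b) * d b ^ |H|`, and `|H|`-th powers determine the elements of `N`. -/
theorem IsCrossedHom.eq_of_prod_eq {G : Type*} [Group G] {N H : Subgroup G} [N.Normal]
    [IsMulCommutative N] [Fintype H] (hcop : (Nat.card N).Coprime (Nat.card H)) {d d' : H → N}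
    (hd : IsCrossedHom d) (hd' : IsCrossedHom d')
    (h : ∏ x, d x = ∏ x, d' x) : d = d' := by
  have key : ∀ f : H → N, IsCrossedHom f → ∀ b : H,
      ∏ x, f x = MulAut.conjNormal (b : G)⁻¹ (∏ x, f x) * f b ^ Nat.card H := by
    intro f hf b
    -- reindex the product by right translation by `b`
    calc ∏ x, f x = ∏ x, f (x * b) := (Equiv.prod_comp (Equiv.mulRight b) f).symm
      _ = _ := by
        simp_rw [show ∀ x, f (x * b) = _ from fun x => hf x b, Finset.prod_mul_distrib, map_prod,
          Finset.prod_const, Finset.card_univ, Nat.card_eq_fintype_card]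
  funext b
  have h1 := key d hd b
  rw [h, key d' hd' b] at h1
  refine (powCoprime hcop).injective (?_ : d b ^ Nat.card H = d' b ^ Nat.card H)
  rw [← key d' hd' b] at h1
  have h2 := key d' hd' b
  exact (mul_left_cancel (h2.symm.trans h1)).symm

/-- The kernel of `f / g` contains an element of order `p`, so it cannot have index `p`. -/
theorem hom_eq_of_apply_eq {H N : Type*} [Group H] [Finite H] [CommGroup N] {p : ℕ}
    (hp : p.Prime) (hN : Nat.card N = p) (hH : ¬ p ^ 2 ∣ Nat.card H) {z : H}
    (hz : orderOf z = p) {f g : H →* N} (h : f z = g z) : f = g := by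
  have : Finite N := Nat.finite_of_card_ne_zero (hN ▸ hp.ne_zero)
  have hker : z ∈ (f / g).ker := by simp [MonoidHom.mem_ker, h]
  have hpk : p ∣ Nat.card (f / g).ker := by
    rw [← hz, ← Subgroup.orderOf_mk z hker]
    exact orderOf_dvd_natCard _
  have hrange := Subgroup.card_subgroup_dvd_card (f / g).range
  rw [hN, Nat.dvd_prime hp, ← Subgroup.index_ker] at hrange
  rcases hrange with h1 | h1
  · rw [Subgroup.index_eq_one, MonoidHom.ker_eq_top_iff] at h1
    exact div_eq_one.mp h1
  · refine absurd ?_ hH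
    rw [← (f / g).ker.card_mul_index, h1, sq]
    exact Nat.mul_dvd_mul_right hpk p

/-- A counting form of Gaschütz's lemma for an abelian minimal normal subgroup `N`: generators of
`G ⧸ N` lift to generators of `G` as soon as each complement of `N` has at most `|N|` crossed
homomorphisms to `N`. -/
theorem isTwoGenerated_of_quotient {G : Type*} [Group G] [Finite G] {N : Subgroup G} [N.Normal]
    [IsMulCommutative N] (hN : N ≠ ⊥)
    (hmin : ∀ M : Subgroup G, M.Normal → M ≤ N → M = ⊥ ∨ M = N)
    (hinj : ∀ H : Subgroup G, H.IsComplement' N → ∃ ev : (H → N) → N,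
      ∀ d d' : H → N, IsCrossedHom d → IsCrossedHom d' → ev d = ev d' → d = d')
    (hQ : IsTwoGenerated (G ⧸ N)) : IsTwoGenerated G := by
  obtain ⟨x', y', hxy⟩ := hQ
  obtain ⟨x, rfl⟩ := QuotientGroup.mk'_surjective N x'
  obtain ⟨y, rfl⟩ := QuotientGroup.mk'_surjective N y'
  by_contra hG
  let K (ab : N × N) : Subgroup G := Subgroup.closure {x * ab.1, y * ab.2}
  have hKsup : ∀ ab, K ab ⊔ N = ⊤ := by
    intro ab
    rw [← QuotientGroup.ker_mk' N, ← Subgroup.comap_map_eq, MonoidHom.map_closure,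
      Set.image_pair, map_mul, map_mul]
    have h1 : ∀ a : N, QuotientGroup.mk' N (a : G) = 1 := fun a =>
      (QuotientGroup.eq_one_iff _).mpr a.2
    rw [h1, h1, mul_one, mul_one, hxy, Subgroup.comap_top]
  -- `K ab ⊓ N` is normalized by `K ab` and centralized by the abelian group `N`
  have hKinf : ∀ ab, K ab ⊓ N = ⊥ := by
    intro ab
    have hnorm : (K ab ⊓ N).Normal := by
      constructor
      intro n hn g
      obtain ⟨k, hk, m, hm, rfl⟩ := Subgroup.mem_sup_of_normal_right.mp
        (hKsup ab ▸ Subgroup.mem_top g)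
      have hc : m * n = n * m := setLike_mul_comm hm hn.2
      have : k * m * n * (k * m)⁻¹ = k * n * k⁻¹ := by
        rw [mul_assoc k, hc]; group
      rw [this]
      exact ⟨(K ab).mul_mem ((K ab).mul_mem hk hn.1) ((K ab).inv_mem hk),
        Subgroup.Normal.conj_mem inferInstance n hn.2 k⟩
    refine (hmin _ hnorm inf_le_right).resolve_right fun h => hG ⟨x * ab.1, y * ab.2, ?_⟩
    rw [← hKsup ab]
    exact (sup_eq_left.mpr (inf_eq_right.mp h)).symm
  have hex : ∀ ab (g : G), ∃ n : N, g * n ∈ K ab := by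
    intro ab g
    obtain ⟨k, hk, m, hm, rfl⟩ := Subgroup.mem_sup_of_normal_right.mp
      (hKsup ab ▸ Subgroup.mem_top g)
    exact ⟨⟨m⁻¹, inv_mem hm⟩, by simpa using hk⟩
  have huniq : ∀ ab (g : G) (n m : N), g * n ∈ K ab → g * m ∈ K ab → n = m := by
    intro ab g n m hn hm
    have h1 : (n : G)⁻¹ * m ∈ K ab ⊓ N := by
      refine ⟨?_, N.mul_mem (N.inv_mem n.2) m.2⟩
      have := mul_mem (inv_mem hn) hm
      rwa [mul_inv_rev, mul_assoc, inv_mul_cancel_left] at this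
    rw [hKinf, Subgroup.mem_bot, inv_mul_eq_one] at h1
    exact Subtype.ext h1
  -- `D ab g` is the element of `N` that moves `g` into the complement `K ab`
  choose D hD using hex
  have hcross : ∀ ab (a b : G), D ab (a * b) = MulAut.conjNormal b⁻¹ (D ab a) * D ab b := by
    intro ab a b
    refine huniq ab (a * b) _ _ (hD ab _) ?_
    have := mul_mem (hD ab a) (hD ab b)
    rw [Subgroup.coe_mul, MulAut.conjNormal_apply]
    convert this using 1
    group
  have hcompl : (K (1, 1)).IsComplement' N := by
    refine Subgroup.isComplement'_of_disjoint_and_mul_eq_univ (disjoint_iff.mpr (hKinf _)) ?_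
    rw [← Subgroup.mul_normal, hKsup, Subgroup.coe_top]
  obtain ⟨ev, hev⟩ := hinj _ hcompl
  have hxK : x ∈ K (1, 1) := Subgroup.subset_closure (by simp)
  have hyK : y ∈ K (1, 1) := Subgroup.subset_closure (by simp)
  have hle : Nat.card (N × N) ≤ Nat.card N := by
    refine Nat.card_le_card_of_injective (fun ab => ev fun h : K (1, 1) => D ab h) ?_
    intro ab ab' h
    have h1 := hev _ _ (fun a b => hcross ab a b) (fun a b => hcross ab' a b) h
    have e1 : ∀ ab, D ab x = ab.1 := fun ab =>
      huniq ab x _ _ (hD ab x) (Subgroup.subset_closure (by simp))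
    have e2 : ∀ ab, D ab y = ab.2 := fun ab =>
      huniq ab y _ _ (hD ab y) (Subgroup.subset_closure (by simp))
    have h2 := congrFun h1 ⟨x, hxK⟩
    have h3 := congrFun h1 ⟨y, hyK⟩
    simp only [e1, e2] at h2 h3
    exact Prod.ext h2 h3
  rw [Nat.card_prod] at hle
  have h1 := (Subgroup.one_lt_card_iff_ne_bot N).mpr hN
  nlinarith

theorem MonoidHom.apply_eq_one_of_coprime_card {G H : Type*} [Group G] [Group H] (f : G →* H)
    (h : (Nat.card G).Coprime (Nat.card H)) (g : G) : f g = 1 := by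
  rw [← orderOf_eq_one_iff]
  exact Nat.eq_one_of_dvd_coprimes h ((orderOf_map_dvd f g).trans (orderOf_dvd_natCard g))
    (orderOf_dvd_natCard _)

/-- Crossed homomorphisms from `H` to `N` are separated by an `N`-valued invariant: the product of
all values if `p ∤ |H|`, the value at an element of order `p` otherwise. -/
theorem IsCrossedHom.exists_injective_invariant {G : Type*} [Group G] [Finite G]
    {N H : Subgroup G} [N.Normal] [IsMulCommutative N] (hcf : IsCubeFree (Nat.card G))
    (hG : ∀ q r : ℕ, q.Prime → r.Prime → q ∣ Nat.card G → q ∣ r - 1 → ¬ r ^ 2 ∣ Nat.card G)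
    {p : ℕ} (hp : p.Prime) (hN : Nat.card N = p ∨ Nat.card N = p ^ 2)
    (hHN : H.IsComplement' N) : ∃ ev : (H → N) → N,
      ∀ d d' : H → N, IsCrossedHom d → IsCrossedHom d' → ev d = ev d' → d = d' := by
  have : Fact p.Prime := ⟨hp⟩
  have hcard : Nat.card H * Nat.card N = Nat.card G := hHN.card_mul_card
  by_cases hpH : p ∣ Nat.card H
  · obtain ⟨m, hm⟩ := hpH
    have hNp : Nat.card N = p := hN.resolve_right fun h =>
      hcf p hp ⟨m, by rw [← hcard, h, hm]; ring⟩
    have hH2 : ¬ p ^ 2 ∣ Nat.card H := by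
      rintro ⟨c, hc⟩
      exact hcf p hp ⟨c, by rw [← hcard, hNp, hc]; ring⟩
    have hsq : p ^ 2 ∣ Nat.card G := ⟨m, by rw [← hcard, hNp, hm]; ring⟩
    have hcyc : IsCyclic N := isCyclic_of_prime_card hNp
    have hconj : ∀ g : G, MulAut.conjNormal (H := N) g = 1 := by
      refine MonoidHom.apply_eq_one_of_coprime_card _ ?_
      rw [hcyc.card_mulAut, hNp, Nat.totient_prime hp]
      exact Nat.coprime_of_dvd fun q hq hqG hqp => hG q p hq hp hqG hqp hsq
    obtain ⟨z, hz⟩ := exists_prime_orderOf_dvd_card' (G := H) p ⟨m, hm⟩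
    refine ⟨fun d => d z, fun d d' hd hd' h => ?_⟩
    have hmul : ∀ f : H → N, IsCrossedHom f → ∀ a b, f (a * b) = f a * f b := by
      intro f hf a b
      rw [hf a b, hconj, MulAut.one_apply]
    let _ : CommGroup N := { mul_comm := mul_comm' }
    exact congrArg DFunLike.coe (hom_eq_of_apply_eq hp hNp hH2 hz
      (f := MonoidHom.mk' d (hmul d hd)) (g := MonoidHom.mk' d' (hmul d' hd')) h)
  · have hcop : (Nat.card N).Coprime (Nat.card H) := by
      have := (Nat.Prime.coprime_iff_not_dvd hp).mpr hpH
      rcases hN with h | h <;> rw [h]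
      · exact this
      · exact this.pow_left 2
    have := Fintype.ofFinite H
    let _ : CommGroup N := { mul_comm := mul_comm' }
    exact ⟨fun d => ∏ x, d x, fun d d' hd hd' h => IsCrossedHom.eq_of_prod_eq hcop hd hd' h⟩

/-! ### The classification -/

theorem isTwoGeneratedNumber_of_odd {n : ℕ} (hn : Odd n) (hcf : IsCubeFree n)
    (h : ∀ q r : ℕ, q.Prime → r.Prime → q ∣ n → q ∣ r - 1 → ¬ r ^ 2 ∣ n) :
    IsTwoGeneratedNumber.{u} n := by
  induction n using Nat.strong_induction_on with
  | _ n ih =>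
    rintro G _ rfl
    have : Finite G := Nat.finite_of_card_ne_zero hn.pos.ne'
    rcases subsingleton_or_nontrivial G with hs | hnt
    · exact ⟨1, 1, Subsingleton.elim _ _⟩
    have hsol := isSolvable_of_odd_of_isCubeFree hn hcf
    obtain ⟨N, p, hnorm, hcomm, hp, hNp, hmin⟩ := exists_minimal_normal_of_isSolvable hcf
    have h1 : 1 < Nat.card N := by
      rcases hNp with h | h <;> rw [h]
      · exact hp.one_lt
      · exact Nat.one_lt_pow two_ne_zero hp.one_lt
    refine isTwoGenerated_of_quotient ((Subgroup.one_lt_card_iff_ne_bot N).mp h1) hmin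
      (fun H hH => IsCrossedHom.exists_injective_invariant hcf h hp hNp hH) ?_
    have hdvd : Nat.card (G ⧸ N) ∣ Nat.card G := Subgroup.card_quotient_dvd_card N
    refine ih (Nat.card (G ⧸ N)) ?_ (hn.of_dvd_nat hdvd) (hcf.of_dvd hdvd)
      (fun q r hq hr hqn hqr hrn => h q r hq hr (hqn.trans hdvd) hqr (hrn.trans hdvd)) _ rfl
    rw [N.card_eq_card_quotient_mul_card_subgroup]
    exact lt_mul_of_one_lt_right Nat.card_pos h1

theorem theorem1 (n : ℕ) (hn : Odd n) (k : ℕ) (p e : Fin k → ℕ)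
    (hp : ∀ i, (p i).Prime) (hanti : StrictAnti p) (he : ∀ i, 0 < e i)
    (hfac : n = ∏ i, p i ^ e i) :
    IsTwoGeneratedNumber.{u} n ↔
      IsCubeFree n ∧ ∀ i j : Fin k, i < j → (¬ p j ∣ p i - 1 ∨ e i = 1) := by
  have hpow : ∀ i, p i ^ e i ∣ n := fun i => hfac ▸ Finset.dvd_prod_of_mem _ (Finset.mem_univ i)
  have hprime : ∀ q, q.Prime → q ∣ n → ∃ i, p i = q := by
    intro q hq hqn
    rw [hfac, hq.prime.dvd_finsetProd_iff] at hqn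
    obtain ⟨i, -, hi⟩ := hqn
    exact ⟨i, ((Nat.prime_dvd_prime_iff_eq hq (hp i)).mp (hq.dvd_of_dvd_pow hi)).symm⟩
  constructor
  · intro h
    refine ⟨h.isCubeFree, fun i j _ => or_iff_not_imp_left.mpr fun hji => ?_⟩
    rw [not_not] at hji
    by_contra hei
    have h2 : 2 ≤ e i := by have := he i; omega
    exact h.not_sq_dvd (hp j) (hp i) ((dvd_pow_self _ (he j).ne').trans (hpow j)) hji
      ((pow_dvd_pow _ h2).trans (hpow i))
  · rintro ⟨hcf, h⟩
    refine isTwoGeneratedNumber_of_odd hn hcf fun q r hq hr hqn hqr hrn => ?_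
    obtain ⟨j, rfl⟩ := hprime q hq hqn
    obtain ⟨i, rfl⟩ := hprime r hr ((dvd_pow_self r two_ne_zero).trans hrn)
    have hlt : p j < p i :=
      (Nat.le_of_dvd (Nat.sub_pos_of_lt hr.one_lt) hqr).trans_lt (Nat.sub_lt hr.pos one_pos)
    have hei := (h i j (hanti.lt_iff_gt.mp hlt)).resolve_left (not_not.mpr hqr)
    -- if `e i = 1`, the cofactor of `p i` in `n` is prime to `p i`
    rw [hfac, ← Finset.mul_prod_erase _ _ (Finset.mem_univ i), hei, pow_one, sq] at hrn
    have h1 := Nat.dvd_of_mul_dvd_mul_left hr.pos hrn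
    rw [hr.prime.dvd_finsetProd_iff] at h1
    obtain ⟨l, hl, hil⟩ := h1
    exact (Finset.ne_of_mem_erase hl) (hanti.injective
      ((Nat.prime_dvd_prime_iff_eq hr (hp l)).mp (hr.dvd_of_dvd_pow hil)).symm)
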